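/- Let $\theta\in\{0,1,\nu\}$ and $R_\theta=\mathbb Z_4+\nu\mathbb Z_4$ with $\nu^2=\theta$. Put $k_\theta=\nu$ if $\theta\in\{0,\nu\}$ and $k_\theta=1+\nu$ if $\theta=1$. Let $\alpha_\theta$ be one of the units $1+\nu,\,1+2\nu,\,1+3\nu$ (if $\theta=0$); $2+\nu,\,3+2\nu,\,3\nu$ (if $\theta=1$); $1+2\nu$ (if $\theta=\nu$). Let $n\ge 1$ and let $C$ be an $\alpha_\theta$-constacyclic code of length $n$ over $R_\theta$, i.e. an $R_\theta$-submodule of $R_\theta^n$ with $\tau(C)=C$ for $\tau(s_0,\dots,s_{n-1})=(\alpha_\theta s_{n-1},s_0,\dots,s_{n-2})$, viewed also as an ideal of $R_\theta[z]/\langle z^n-\alpha_\theta\rangle$ through $s\mapsto\sum_i s_iz^i$. It is reversible if $(s_{n-1},\dots,s_0)\in C$ for all $(s_0,\dots,s_{n-1})\in C$. Binary polynomials are read over $\mathbb Z_4$ and $R_\theta$ with coefficients $0,1$. For $a\in\mathbb Z_4[z]$, say $a\in\mathrm{Tor}(C)$ if $k_\theta a(z)\in C$, and $a\in\mathrm{Res}(C)$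 if $a(z)+k_\theta b(z)\in C$ for some $b\in\mathbb Z_4[z]$. Put $C_1=\{a\in\mathbb Z_2[z]: a+2b\in\mathrm{Res}(C)\text{ for some }b\in\mathbb Z_2[z]\}$, $C_2=\{a\in\mathbb Z_2[z]: 2a\in\mathrm{Res}(C)\}$, $C_3=\{a\in\mathbb Z_2[z]: a+2b\in\mathrm{Tor}(C)\text{ for some }b\in\mathbb Z_2[z]\}$, $C_4=\{a\in\mathbb Z_2[z]: 2a\in\mathrm{Tor}(C)\}$; these are ideals of $\mathbb Z_2[z]$ containing $z^n-1$. Suppose that $C$ is generated, as an ideal, in the unique form, that is, by $$h_{\theta_1}=h_{11}+2h_{12}+k_\theta h_{13}+2k_\theta h_{14},\quad h_{\theta_2}=2h_{22}+k_\theta h_{23}+2k_\theta h_{24},\quad h_{\theta_3}=k_\theta h_{33}+2k_\theta h_{34},\quad h_{\theta_4}=2k_\theta h_{44},$$ where the $h_{ij}$ are binary polynomials, $h_{ii}$ generates the ideal $C_i$ of $\mathbb Z_2[z]$ (so $h_{ii}\mid z^n-1$; if $h_{ii}=z^n-1$, then its degree is $n$, and in the generators above, where $h_{ii}$ stands for an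 element of $\mathbb Z_2[z]/\langle z^n-1\rangle$, it is read as $0$), and for $i<j$ either $h_{ij}=0$ or $\deg h_{ij}<\deg h_{jj}$. Put $\mathsf h_1=h_{13}+2h_{14}$ and $\mathsf h_2=h_{23}+2h_{24}$ in $\mathbb Z_4[z]$. For a polynomial $g$ let $g^*(z)=z^{\deg g}g(1/z)$ (with $0^*=0$), and call $g$ self-reciprocal if $g^*=g$. Then $C$ is reversible if and only if the following four conditions hold: (i) $h_{11},h_{22},h_{33},h_{44}$ are self-reciprocal; (ii) $h_{44}\mid z^{\alpha}h_{34}^*-h_{34}$ in $\mathbb Z_2[z]$, where $\alpha=\deg h_{33}-\deg h_{34}$; (iii) $2(z^{\beta}h_{12}^*-h_{12})+k_\theta(z^{\gamma}\mathsf h_1^*-\mathsf h_1)\in C$, where $\beta=\deg h_{11}-\deg h_{12}$ and $\gamma=\deg h_{11}-\deg\mathsf h_1$; (iv) $z^{\delta}\mathsf h_2^*-\mathsf h_2\in\mathrm{Tor}(C)$, where $\delta=\deg h_{22}-\deg\mathsf h_2$; if $\delta<0$, this is read, after multiplication by $z^{-\delta}$, as $\mathsf h_2^*-z^{-\delta}\mathsf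 h_2\in\mathrm{Tor}(C)$. (An exponent belonging to a zero polynomial is immaterial; if $h_{34}$, $h_{12}$, $\mathsf h_1$ is nonzero, then $\alpha$, $\beta$, $\gamma$ respectively is nonnegative.) -/

import Mathlib

open Polynomial

/-- The three admissible values `θ = 0`, `θ = 1`, `θ = ν` of `ν ^ 2`. -/
inductive Theta where
  | zero
  | one
  | nu

/-- `θ = θ.a + θ.b ν` as an element of `Z₄ + ν Z₄`. -/
def Theta.a : Theta → ZMod 4
  | .zero => 0
  | .one => 1
  | .nu => 0

/-- `θ = θ.a + θ.b ν` as an element of `Z₄ + ν Z₄`. -/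
def Theta.b : Theta → ZMod 4
  | .zero => 0
  | .one => 0
  | .nu => 1

/-- The ring `R_θ = Z₄ + ν Z₄` with `ν ^ 2 = θ`; the element `x + ν y` is `⟨x, y⟩`. -/
abbrev RTheta (θ : Theta) : Type := QuadraticAlgebra (ZMod 4) θ.a θ.b

/-- `k_θ = ν` for `θ ∈ {0, ν}` and `k_θ = 1 + ν` for `θ = 1`. -/
def kTheta : (θ : Theta) → RTheta θ
  | .zero => ⟨0, 1⟩
  | .one => ⟨1, 1⟩
  | .nu => ⟨0, 1⟩

/-- The units `α_θ`: `1 + ν, 1 + 2ν, 1 + 3ν` for `θ = 0`, `2 + ν, 3 + 2ν, 3ν` for `θ = 1`,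
and `1 + 2ν` for `θ = ν`. -/
def alphaUnits : (θ : Theta) → Set (RTheta θ)
  | .zero => {⟨1, 1⟩, ⟨1, 2⟩, ⟨1, 3⟩}
  | .one => {⟨2, 1⟩, ⟨3, 2⟩, ⟨0, 3⟩}
  | .nu => {⟨1, 2⟩}

section Codes

variable {R : Type*} [CommRing R] {n : ℕ}

/-- The `lam`-constacyclic shift `(s₀, …, sₙ₋₁) ↦ (lam * sₙ₋₁, s₀, …, sₙ₋₂)`
(subtraction in `Fin n` is cyclic). -/
def constaShift [NeZero n] (lam : R) (s : Fin n → R) : Fin n → R :=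
  fun i => if i = 0 then lam * s (i - 1) else s (i - 1)

/-- A linear code `C` of length `n` over `R` is `lam`-constacyclic if `τ(C) = C` for the
`lam`-constacyclic shift `τ`. -/
def IsConstacyclic [NeZero n] (lam : R) (C : Submodule R (Fin n → R)) : Prop :=
  constaShift lam '' (C : Set (Fin n → R)) = C

/-- A code is reversible if it contains the reverse `(sₙ₋₁, …, s₀)` of each codeword. -/
def IsReversible (C : Submodule R (Fin n → R)) : Prop :=
  ∀ s ∈ C, (fun i => s (Fin.rev i)) ∈ C

/-- The polynomial `s₀ + s₁ z + ⋯ + sₙ₋₁ zⁿ⁻¹` of a word. -/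
noncomputable def wordPoly (s : Fin n → R) : R[X] :=
  ∑ i : Fin n, Polynomial.C (s i) * X ^ (i : ℕ)

/-- The ring `R[z] / ⟨zⁿ - lam⟩`. -/
abbrev ConstaRing (n : ℕ) (lam : R) : Type _ :=
  R[X] ⧸ Ideal.span {(X ^ n - Polynomial.C lam : R[X])}

/-- The class of a polynomial in `R[z] / ⟨zⁿ - lam⟩`. -/
noncomputable def toConsta (n : ℕ) (lam : R) : R[X] →+* ConstaRing n lam :=
  Ideal.Quotient.mk _

/-- A code of length `n` viewed as a subset of `R[z] / ⟨zⁿ - lam⟩`. -/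
def codeSet (lam : R) (C : Submodule R (Fin n → R)) : Set (ConstaRing n lam) :=
  {x | ∃ s ∈ C, toConsta n lam (wordPoly s) = x}

end Codes

/-- A binary polynomial read over `Z₄`, with coefficients `0, 1 ∈ Z₄`. -/
noncomputable def lift4 (p : (ZMod 2)[X]) : (ZMod 4)[X] :=
  ∑ i ∈ p.support, X ^ i

/-- The representative of degree `< n` of the class of `p` in `Z₂[z] / ⟨zⁿ - 1⟩`, read over `Z₄`. -/
noncomputable def rep4 (n : ℕ) (p : (ZMod 2)[X]) : (ZMod 4)[X] :=
  lift4 (p %ₘ (X ^ n - 1))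

/-- A polynomial over `Z₄` read over `R_θ`. -/
noncomputable def toR (θ : Theta) (p : (ZMod 4)[X]) : (RTheta θ)[X] :=
  p.map (algebraMap (ZMod 4) (RTheta θ))

section Layers

variable {θ : Theta} {n : ℕ}

/-- `Res(C)`: the `a(z)` over `Z₄` with `a(z) + k_θ b(z) ∈ C` for some `b(z)` over `Z₄`. -/
def resCode (α : RTheta θ) (C : Submodule (RTheta θ) (Fin n → RTheta θ)) : Set (ZMod 4)[X] :=
  {a | ∃ b : (ZMod 4)[X],
    toConsta n α (toR θ a + Polynomial.C (kTheta θ) * toR θ b) ∈ codeSet α C}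

/-- `Tor(C)`: the `a(z)` over `Z₄` with `k_θ a(z) ∈ C`. -/
def torCode (α : RTheta θ) (C : Submodule (RTheta θ) (Fin n → RTheta θ)) : Set (ZMod 4)[X] :=
  {a | toConsta n α (Polynomial.C (kTheta θ) * toR θ a) ∈ codeSet α C}

/-- `Res(D)` for a code `D` over `Z₄`: the binary `a(z)` with `a(z) + 2 b(z) ∈ D` for some `b(z)`. -/
def resTwo (D : Set (ZMod 4)[X]) : Set (ZMod 2)[X] :=
  {a | ∃ b : (ZMod 2)[X], lift4 a + 2 * lift4 b ∈ D}

/-- `Tor(D)` for a code `D` over `Z₄`: the binary `a(z)` with `2 a(z) ∈ D`. -/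
def torTwo (D : Set (ZMod 4)[X]) : Set (ZMod 2)[X] :=
  {a | 2 * lift4 a ∈ D}

end Layers

/-- The ten binary polynomials `h_ij`, `1 ≤ i ≤ j ≤ 4`. -/
structure GenPolys where
  h11 : (ZMod 2)[X]
  h12 : (ZMod 2)[X]
  h13 : (ZMod 2)[X]
  h14 : (ZMod 2)[X]
  h22 : (ZMod 2)[X]
  h23 : (ZMod 2)[X]
  h24 : (ZMod 2)[X]
  h33 : (ZMod 2)[X]
  h34 : (ZMod 2)[X]
  h44 : (ZMod 2)[X]

namespace GenPolys

/-- `𝗁₁ = h₁₃ + 2 h₁₄`. -/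
noncomputable def sh1 (h : GenPolys) : (ZMod 4)[X] := lift4 h.h13 + 2 * lift4 h.h14

/-- `𝗁₂ = h₂₃ + 2 h₂₄`. -/
noncomputable def sh2 (h : GenPolys) : (ZMod 4)[X] := lift4 h.h23 + 2 * lift4 h.h24

/-- `h_θ₁ = h₁₁ + 2 h₁₂ + k_θ h₁₃ + 2 k_θ h₁₄`. -/
noncomputable def gen1 (h : GenPolys) (θ : Theta) (n : ℕ) : (RTheta θ)[X] :=
  toR θ (rep4 n h.h11 + 2 * lift4 h.h12) + Polynomial.C (kTheta θ) * toR θ h.sh1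

/-- `h_θ₂ = 2 h₂₂ + k_θ h₂₃ + 2 k_θ h₂₄`. -/
noncomputable def gen2 (h : GenPolys) (θ : Theta) (n : ℕ) : (RTheta θ)[X] :=
  toR θ (2 * rep4 n h.h22) + Polynomial.C (kTheta θ) * toR θ h.sh2

/-- `h_θ₃ = k_θ h₃₃ + 2 k_θ h₃₄`. -/
noncomputable def gen3 (h : GenPolys) (θ : Theta) (n : ℕ) : (RTheta θ)[X] :=
  Polynomial.C (kTheta θ) * toR θ (rep4 n h.h33 + 2 * lift4 h.h34)

/-- `h_θ₄ = 2 k_θ h₄₄`. -/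
noncomputable def gen4 (h : GenPolys) (θ : Theta) (n : ℕ) : (RTheta θ)[X] :=
  Polynomial.C (kTheta θ) * toR θ (2 * rep4 n h.h44)

/-- `C` is generated by `h_θ₁, …, h_θ₄` in the unique form: `h_ii` is the minimal degree generator
of the binary cyclic code `C_θi` (equivalently the divisor of `zⁿ - 1` whose multiples are the
polynomials in `C_θi`; the zero code has `h_ii = zⁿ - 1`, which is zero in
`Z₂[z] / ⟨zⁿ - 1⟩`), and `h_ij = 0` or `deg h_ij < deg h_jj` for `i < j`. -/
structure IsUniqueForm {θ : Theta} {n : ℕ} (h : GenPolys) (α : RTheta θ)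
    (C : Submodule (RTheta θ) (Fin n → RTheta θ)) : Prop where
  span_eq : codeSet α C = (Ideal.span {toConsta n α (h.gen1 θ n), toConsta n α (h.gen2 θ n),
    toConsta n α (h.gen3 θ n), toConsta n α (h.gen4 θ n)} : Ideal (ConstaRing n α))
  layer1 : ∀ a, a ∈ resTwo (resCode α C) ↔ h.h11 ∣ a
  layer2 : ∀ a, a ∈ torTwo (resCode α C) ↔ h.h22 ∣ a
  layer3 : ∀ a, a ∈ resTwo (torCode α C) ↔ h.h33 ∣ a
  layer4 : ∀ a, a ∈ torTwo (torCode α C) ↔ h.h44 ∣ a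
  deg12 : h.h12 = 0 ∨ h.h12.natDegree < h.h22.natDegree
  deg13 : h.h13 = 0 ∨ h.h13.natDegree < h.h33.natDegree
  deg14 : h.h14 = 0 ∨ h.h14.natDegree < h.h44.natDegree
  deg23 : h.h23 = 0 ∨ h.h23.natDegree < h.h33.natDegree
  deg24 : h.h24 = 0 ∨ h.h24.natDegree < h.h44.natDegree
  deg34 : h.h34 = 0 ∨ h.h34.natDegree < h.h44.natDegree

end GenPolys

/-- `g` is self-reciprocal: `g* = g`, where `g*(z) = z ^ (deg g) g(1/z)`. -/
def IsSelfReciprocal {R : Type*} [CommRing R] (g : R[X]) : Prop := g.reverse = g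

/-! Let Q be the quotient of R_θ[z] by the ideal of the code. In Q the variable z is a unit, so
polynomials over Z₄ have two evaluations, E at z and E' at z⁻¹; since R_θ = Z₄ + k_θ Z₄, a codeword
is a relation E a + K E b = 0. Reversing a word of length n multiplies its value at z⁻¹ by the unit
zⁿ⁻¹, so reversibility says that relations with a, b of degree < n survive the replacement of E by
E'.

It suffices to test this on the four generators: dividing by h₁₁, h₂₂, h₃₃, h₄₄ in turn peels any
relation down to zero, and the same division works for E' because α⁻¹ and α agree after
multiplication by 2 or by k_θ (`map'_two_mul_add_eq_zero`, `evalReversible_of_gens`).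

For a single generator, multiplication by a power of z turns values at z⁻¹ into values of reflected
polynomials. The layer conditions then give h_ii ∣ h_ii* up to a power of z, hence self-reciprocity.
Once h_ii is self-reciprocal, subtracting the generator (times a power of z for the second) cancels
the h_ii terms; what remains is conditions (ii), (iii), (iv), and nothing for the fourth generator
(`gen1_iff`, `gen2_iff`, `gen3_iff`, `gen4_of`). The delicate bound is deg 𝗁₁ ≤ deg h₁₁
(`natDegree_sh1_le`). -/

/-- Reduction of a polynomial over `Z₄` modulo `2`. -/
noncomputable def red : (ZMod 4)[X] →+* (ZMod 2)[X] :=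
  Polynomial.mapRingHom (ZMod.castHom (by decide : 2 ∣ 4) (ZMod 2))

/-! ### Polynomials over Z₄ and their reduction modulo 2. -/

theorem coeff_red (f : (ZMod 4)[X]) (i : ℕ) :
    (red f).coeff i = ZMod.castHom (by decide : 2 ∣ 4) (ZMod 2) (f.coeff i) := by
  simp [red]

theorem coeff_lift4 (p : (ZMod 2)[X]) (i : ℕ) :
    (lift4 p).coeff i = if p.coeff i = 0 then 0 else 1 := by
  simp only [lift4, finsetSum_coeff, coeff_X_pow]
  rw [Finset.sum_ite_eq p.support i (fun _ => (1 : ZMod 4))]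
  by_cases hp : p.coeff i = 0 <;> simp [hp]

theorem red_lift4 (p : (ZMod 2)[X]) : red (lift4 p) = p := by
  ext i
  rw [coeff_red, coeff_lift4]
  generalize p.coeff i = x
  revert x
  decide

theorem lift4_zero : lift4 0 = 0 := by simp [lift4]

theorem red_X : red X = X := by simp [red]

theorem red_two_mul (f : (ZMod 4)[X]) : red (2 * f) = 0 := by
  ext i
  rw [coeff_red, two_mul, coeff_add, coeff_zero]
  generalize f.coeff i = x
  revert x
  decide

theorem exists_two_mul_of_red_eq_zero {f : (ZMod 4)[X]} (hf : red f = 0) :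
    ∃ g, f = 2 * g := by
  -- Coefficients of f that vanish modulo 2 are 0 or 2, so the indicator of the support is a half of
  -- f.
  refine ⟨∑ i ∈ f.support, monomial i (if f.coeff i = 0 then 0 else 1), ?_⟩
  ext i
  have h0 : (red f).coeff i = 0 := by rw [hf, coeff_zero]
  rw [coeff_red] at h0
  rw [two_mul, coeff_add]
  simp only [finsetSum_coeff, coeff_monomial, Finset.sum_ite_eq', mem_support_iff]
  revert h0
  generalize f.coeff i = x
  revert x
  decide

theorem exists_eq_add_two_mul {f g : (ZMod 4)[X]} (hfg : red f = red g) :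
    ∃ b, f = g + 2 * b := by
  obtain ⟨b, hb⟩ := exists_two_mul_of_red_eq_zero (f := f - g) (by rw [map_sub, hfg, sub_self])
  exact ⟨b, by rw [← hb]; ring⟩

theorem four_eq_zero : (4 : (ZMod 4)[X]) = 0 := by
  have h : (C (4 : ZMod 4) : (ZMod 4)[X]) = 0 := by
    rw [show (4 : ZMod 4) = 0 from rfl, C_0]
  rwa [map_ofNat] at h

/-- Since 4 = 0, a double depends only on the reduction; this lets the layers of elements 2a be
handled as binary codes. -/
theorem two_mul_eq_of_red_eq {f g : (ZMod 4)[X]} (hfg : red f = red g) : 2 * f = 2 * g := by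
  obtain ⟨b, rfl⟩ := exists_eq_add_two_mul hfg
  linear_combination b * four_eq_zero

theorem exists_eq_lift4_add (f : (ZMod 4)[X]) : ∃ b, f = lift4 (red f) + 2 * lift4 b := by
  obtain ⟨b, hb⟩ := exists_eq_add_two_mul (red_lift4 (red f)).symm
  refine ⟨red b, ?_⟩
  rw [two_mul_eq_of_red_eq (red_lift4 (red b))]
  exact hb

theorem reflect_lift4 (m : ℕ) (p : (ZMod 2)[X]) : reflect m (lift4 p) = lift4 (reflect m p) := by
  ext i
  rw [coeff_lift4, coeff_reflect, coeff_reflect, coeff_lift4]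

theorem red_reflect (m : ℕ) (f : (ZMod 4)[X]) : red (reflect m f) = reflect m (red f) := by
  ext i
  rw [coeff_red, coeff_reflect, coeff_reflect, coeff_red]

theorem natDegree_lift4_le (p : (ZMod 2)[X]) : (lift4 p).natDegree ≤ p.natDegree := by
  rw [natDegree_le_iff_coeff_eq_zero]
  intro i hi
  rw [coeff_lift4, coeff_eq_zero_of_natDegree_lt hi, if_pos rfl]

theorem natDegree_red_le (f : (ZMod 4)[X]) : (red f).natDegree ≤ f.natDegree :=
  natDegree_map_le

theorem monic_of_ne_zero_two {p : (ZMod 2)[X]} (hp : p ≠ 0) : p.Monic := by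
  have h := leadingCoeff_ne_zero.mpr hp
  rw [Monic]
  revert h
  generalize p.leadingCoeff = x
  revert x
  decide

theorem natDegree_X_pow_sub_one_two {n : ℕ} : (X ^ n - 1 : (ZMod 2)[X]).natDegree = n := by
  simpa using natDegree_X_pow_sub_C (n := n) (r := (1 : ZMod 2))

theorem X_pow_sub_one_ne_zero_two {n : ℕ} (hn : n ≠ 0) : (X ^ n - 1 : (ZMod 2)[X]) ≠ 0 := by
  simpa using X_pow_sub_C_ne_zero (Nat.pos_of_ne_zero hn) (1 : ZMod 2)

/-! ### Binary divisors of zⁿ - 1 and self-reciprocity. -/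

section Divisors

variable {n : ℕ} {p : (ZMod 2)[X]}

theorem natDegree_le_of_dvd_X_pow_sub_one (hn : n ≠ 0) (hp : p ∣ X ^ n - 1) : p.natDegree ≤ n :=
  (natDegree_le_of_dvd hp (X_pow_sub_one_ne_zero_two hn)).trans_eq natDegree_X_pow_sub_one_two

theorem ne_zero_of_dvd_X_pow_sub_one (hn : n ≠ 0) (hp : p ∣ X ^ n - 1) : p ≠ 0 :=
  ne_zero_of_dvd_ne_zero (X_pow_sub_one_ne_zero_two hn) hp

/-- The representative of a divisor of `zⁿ - 1` is the divisor itself, except for `zⁿ - 1`. -/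
theorem rep4_cases (hn : n ≠ 0) (hp : p ∣ X ^ n - 1) :
    p.natDegree < n ∧ rep4 n p = lift4 p ∨ p = X ^ n - 1 ∧ rep4 n p = 0 := by
  have h0 := X_pow_sub_one_ne_zero_two hn
  have hm : (X ^ n - 1 : (ZMod 2)[X]).Monic := monic_of_ne_zero_two h0
  rcases (natDegree_le_of_dvd_X_pow_sub_one hn hp).lt_or_eq with hlt | heq
  · refine Or.inl ⟨hlt, ?_⟩
    rw [rep4, (modByMonic_eq_self_iff hm).mpr]
    apply degree_lt_degree
    rwa [natDegree_X_pow_sub_one_two]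
  · have hpe : p = X ^ n - 1 := by
      refine eq_of_monic_of_associated (monic_of_ne_zero_two (ne_zero_of_dvd_ne_zero h0 hp)) hm ?_
      refine associated_of_dvd_of_natDegree_le hp h0 ?_
      rw [heq, natDegree_X_pow_sub_one_two]
    refine Or.inr ⟨hpe, ?_⟩
    rw [rep4, hpe, (modByMonic_eq_zero_iff_dvd hm).mpr dvd_rfl, lift4_zero]

theorem natDegree_rep4_lt (hn : n ≠ 0) (hp : p ∣ X ^ n - 1) : (rep4 n p).natDegree < n := by
  rcases rep4_cases hn hp with ⟨hlt, he⟩ | ⟨-, he⟩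
  · rw [he]; exact (natDegree_lift4_le p).trans_lt hlt
  · rw [he]; simpa using Nat.pos_of_ne_zero hn

theorem natDegree_rep4_le (hn : n ≠ 0) (hp : p ∣ X ^ n - 1) :
    (rep4 n p).natDegree ≤ p.natDegree := by
  rcases rep4_cases hn hp with ⟨-, he⟩ | ⟨-, he⟩
  · rw [he]; exact natDegree_lift4_le p
  · rw [he]; simp

/-- The degree bound serves the case p = zⁿ - 1, whose representative is 0: a multiple of p of
degree < n must then vanish. -/
theorem red_rep4_dvd (hn : n ≠ 0) (hp : p ∣ X ^ n - 1) {f : (ZMod 4)[X]}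
    (hf : f.natDegree < n) (hpf : p ∣ red f) : red (rep4 n p) ∣ red f := by
  rcases rep4_cases hn hp with ⟨-, he⟩ | ⟨hpe, he⟩
  · rwa [he, red_lift4]
  · rw [hpe] at hpf
    rw [eq_zero_of_dvd_of_natDegree_lt hpf
      (by rw [natDegree_X_pow_sub_one_two]; exact (natDegree_red_le f).trans_lt hf)]
    exact dvd_zero _

theorem reflect_rep4 (hn : n ≠ 0) (hp : p ∣ X ^ n - 1) (hr : IsSelfReciprocal p) :
    reflect p.natDegree (rep4 n p) = rep4 n p := by
  rcases rep4_cases hn hp with ⟨-, he⟩ | ⟨-, he⟩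
  · rw [he, reflect_lift4]
    congr 1
  · rw [he, reflect_zero]

theorem isCoprime_X_pow_of_dvd (hn : n ≠ 0) (hp : p ∣ X ^ n - 1) (m : ℕ) :
    IsCoprime p (X ^ m) := by
  refine IsCoprime.pow_right (IsCoprime.of_isCoprime_of_dvd_left ?_ hp)
  refine ⟨-1, X ^ (n - 1), ?_⟩
  rw [← pow_succ, Nat.sub_add_cancel (Nat.one_le_iff_ne_zero.mpr hn)]
  ring

/-- A divisor of `zⁿ - 1` over `Z₂` dividing one of its reflections is self-reciprocal. -/
theorem isSelfReciprocal_of_dvd_reflect (hn : n ≠ 0) (hp : p ∣ X ^ n - 1) {m : ℕ}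
    (hm : p.natDegree ≤ m) (hd : p ∣ reflect m p) : IsSelfReciprocal p := by
  have hX : reflect m p = X ^ (m - p.natDegree) * p.reverse := by
    have h := reflect_mul (1 : (ZMod 2)[X]) p (F := m - p.natDegree) (G := p.natDegree)
      (by simp) le_rfl
    rw [one_mul, Nat.sub_add_cancel hm] at h
    rw [h, reverse, reflect_one]
  rw [hX] at hd
  -- A divisor of zⁿ - 1 is coprime to z, so the power of z can be dropped; p then divides p*, whose
  -- degree is no larger, and nonzero binary polynomials are monic.
  have hd' := (isCoprime_X_pow_of_dvd hn hp _).dvd_of_dvd_mul_left hd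
  have hp0 := ne_zero_of_dvd_X_pow_sub_one hn hp
  have hr0 : p.reverse ≠ 0 := by simpa using hp0
  refine (eq_of_monic_of_associated (monic_of_ne_zero_two hp0) (monic_of_ne_zero_two hr0)
    (associated_of_dvd_of_natDegree_le hd' hr0 ?_)).symm
  exact reverse_natDegree_le p

theorem isSelfReciprocal_X_pow_sub_one (hn : n ≠ 0) :
    IsSelfReciprocal (X ^ n - 1 : (ZMod 2)[X]) := by
  refine isSelfReciprocal_of_dvd_reflect hn dvd_rfl (m := n) natDegree_X_pow_sub_one_two.le ?_
  have h : reflect n (X ^ n - 1 : (ZMod 2)[X]) = -(X ^ n - 1) := by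
    rw [reflect_sub, reflect_one, reflect_monomial, revAt_le le_rfl]
    simp
  rw [h]
  exact (dvd_neg).mpr dvd_rfl

end Divisors

/-- The ring `Q = R_θ[z] / I` for the ideal `I` of a code, presented by the two evaluations
`E : z ↦ z` and `E' : z ↦ z⁻¹` of polynomials over `Z₄` and the class `K` of `k_θ`. -/
structure ReversalData (n : ℕ) (h : GenPolys) {Q : Type*} [CommRing Q]
    (E E' : (ZMod 4)[X] →+* Q) (K : Q) (c t : ZMod 4) : Prop where
  inv : E X * E' X = 1
  pow : E (X ^ n - 1) = E (C c) * K
  -- Here z⁻ⁿ = α⁻¹, which is matched with α = 1 + c k_θ only after multiplication by 2 or by k_θ.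
  two_mul_pow' : 2 * E' (X ^ n - 1) = 2 * (E (C c) * K)
  mul_pow' : K * E' (X ^ n - 1) = K * (E (C c) * K)
  sq : K * K = E (C t) * K
  even : ∃ e, c * t = 2 * e
  t_cases : (∃ e, t = 2 * e) ∨ t = 1
  gen1 : E (rep4 n h.h11 + 2 * lift4 h.h12) + K * E h.sh1 = 0
  gen2 : 2 * E (rep4 n h.h22) + K * E h.sh2 = 0
  gen3 : K * E (rep4 n h.h33 + 2 * lift4 h.h34) = 0
  gen4 : 2 * (K * E (rep4 n h.h44)) = 0
  layer1 : ∀ a b, E a + K * E b = 0 → h.h11 ∣ red a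
  layer2 : ∀ a b, 2 * E a + K * E b = 0 → h.h22 ∣ red a
  layer3 : ∀ a, K * E a = 0 → h.h33 ∣ red a
  layer4 : ∀ a, 2 * (K * E a) = 0 ↔ h.h44 ∣ red a
  exists1 : ∃ a b, red a = h.h11 ∧ E a + K * E b = 0
  exists3 : ∃ a, red a = h.h33 ∧ K * E a = 0
  deg12 : h.h12 = 0 ∨ h.h12.natDegree < h.h22.natDegree
  deg13 : h.h13 = 0 ∨ h.h13.natDegree < h.h33.natDegree
  deg14 : h.h14 = 0 ∨ h.h14.natDegree < h.h44.natDegree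
  deg23 : h.h23 = 0 ∨ h.h23.natDegree < h.h33.natDegree
  deg24 : h.h24 = 0 ∨ h.h24.natDegree < h.h44.natDegree
  deg34 : h.h34 = 0 ∨ h.h34.natDegree < h.h44.natDegree

/-- Reversibility of the code, in terms of the two evaluations. -/
def EvalReversible (n : ℕ) {Q : Type*} [CommRing Q] (E E' : (ZMod 4)[X] →+* Q) (K : Q) : Prop :=
  ∀ a b : (ZMod 4)[X], a.natDegree < n → b.natDegree < n →
    E a + K * E b = 0 → E' a + K * E' b = 0

theorem natDegree_lift4_lt {p : (ZMod 2)[X]} {m : ℕ} (hm : m ≠ 0) (hp : p = 0 ∨ p.natDegree < m) :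
    (lift4 p).natDegree < m := by
  rcases hp with rfl | hp
  · simpa [lift4_zero] using Nat.pos_of_ne_zero hm
  · exact (natDegree_lift4_le p).trans_lt hp

theorem natDegree_two_mul_le (f : (ZMod 4)[X]) : (2 * f).natDegree ≤ f.natDegree := by
  rw [two_mul]
  exact (natDegree_add_le f f).trans_eq (max_self _)

theorem natDegree_add_two_mul_lt {f g : (ZMod 4)[X]} {m : ℕ} (hf : f.natDegree < m)
    (hg : g.natDegree < m) : (f + 2 * g).natDegree < m :=
  (natDegree_add_le _ _).trans_lt (max_lt hf ((natDegree_two_mul_le g).trans_lt hg))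

theorem natDegree_add_two_mul_le {f g : (ZMod 4)[X]} {m : ℕ} (hf : f.natDegree ≤ m)
    (hg : g.natDegree ≤ m) : (f + 2 * g).natDegree ≤ m :=
  (natDegree_add_le _ _).trans (max_le hf ((natDegree_two_mul_le g).trans hg))

theorem exists_natDegree_lt_add_mul {n : ℕ} (hn : n ≠ 0) (r : ZMod 4) (f : (ZMod 4)[X]) :
    ∃ f₀ f₁ : (ZMod 4)[X], f₀.natDegree < n ∧ f = f₀ + (X ^ n - C r) * f₁ := by
  have : Fact (1 < 4) := ⟨by norm_num⟩
  have hm : (X ^ n - C r : (ZMod 4)[X]).Monic := monic_X_pow_sub_C r hn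
  refine ⟨f %ₘ (X ^ n - C r), f /ₘ (X ^ n - C r), ?_, (modByMonic_add_div f (X ^ n - C r)).symm⟩
  have h := natDegree_modByMonic_lt f hm (by
    intro h1
    have := congrArg natDegree h1
    rw [natDegree_X_pow_sub_C, natDegree_one] at this
    exact hn this)
  rwa [natDegree_X_pow_sub_C] at h

/-- `E (reflect m f) = zᵐ f(1/z)`. -/
theorem map_reflect_eq {Q : Type*} [CommRing Q] {E E' : (ZMod 4)[X] →+* Q} (hE : E X * E' X = 1)
    {m : ℕ} {f : (ZMod 4)[X]} (hf : f.natDegree ≤ m) : E (reflect m f) = E X ^ m * E' f := by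
  -- A homomorphism out of Z₄[X] is fixed by the image of X, as Z₄ has at most one homomorphism to a
  -- ring.
  have hev : ∀ F : (ZMod 4)[X] →+* Q, ∀ g, F g = eval₂ (E.comp C) (F X) g := by
    intro F g
    rw [show E.comp C = F.comp C from RingHom.ext_zmod _ _, ← coe_eval₂RingHom]
    congr 1
    ext1
    · exact RingHom.ext_zmod _ _
    · simp
  let _ : Invertible (E' X) := ⟨E X, hE, by rw [mul_comm]; exact hE⟩
  have h := eval₂_reflect_mul_pow (E.comp C) (E' X) m f hf
  rw [← hev E' f, show ⅟(E' X) = E X from rfl, ← hev E] at h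
  rw [← h, mul_left_comm, ← mul_pow, hE, one_pow, mul_one]

theorem map_reverse_eq {Q : Type*} [CommRing Q] {E E' : (ZMod 4)[X] →+* Q} (hE : E X * E' X = 1)
    (f : (ZMod 4)[X]) : E f.reverse = E X ^ f.natDegree * E' f :=
  map_reflect_eq hE le_rfl

theorem pow_mul_eq_zero_iff {Q : Type*} [CommRing Q] {x y : Q} (hxy : x * y = 1) (m : ℕ) (q : Q) :
    x ^ m * q = 0 ↔ q = 0 := by
  refine ⟨fun h => ?_, fun h => by rw [h, mul_zero]⟩
  calc q = y ^ m * (x ^ m * q) := by rw [← mul_assoc, ← mul_pow, mul_comm y x, hxy]; simp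
    _ = 0 := by rw [h, mul_zero]

theorem isSelfReciprocal_of_dvd_red_reflect {n : ℕ} (hn : n ≠ 0)
    {p : (ZMod 2)[X]} (hp : p ∣ X ^ n - 1)
    {m : ℕ} (hm : p.natDegree ≤ m) (hd : p ∣ red (reflect m (rep4 n p))) :
    IsSelfReciprocal p := by
  rcases rep4_cases hn hp with ⟨-, he⟩ | ⟨he, -⟩
  · rw [he, red_reflect, red_lift4] at hd
    exact isSelfReciprocal_of_dvd_reflect hn hp hm hd
  · rw [he]; exact isSelfReciprocal_X_pow_sub_one hn

/-! ### Consequences of the relations in the quotient ring. -/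

namespace ReversalData

variable {n : ℕ} {h : GenPolys} {Q : Type*} [CommRing Q] {E E' : (ZMod 4)[X] →+* Q} {K : Q}
  {c t : ZMod 4} (D : ReversalData n h E E' K c t)

theorem map_C' (E E' : (ZMod 4)[X] →+* Q) (r : ZMod 4) : E' (C r) = E (C r) := by
  change (E'.comp C) r = (E.comp C) r
  rw [RingHom.ext_zmod (E'.comp C) (E.comp C)]

include E in
theorem four : (4 : Q) = 0 := by
  simpa only [map_ofNat, map_zero] using congrArg E four_eq_zero

include D

theorem two_mul_ct : 2 * (E (C c) * E (C t)) = 0 := by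
  obtain ⟨e, he⟩ := D.even
  rw [← map_mul, ← C_mul, he, C_mul, map_mul, map_ofNat, map_ofNat]
  linear_combination E (C e) * four (E := E)

/-- As K² = tK, the relation zⁿ - 1 = cK gives K zⁿ = (1 + ct) K: multiples of K may be reduced
modulo a monic polynomial over Z₄. -/
theorem mul_map_modulus (f : (ZMod 4)[X]) : K * E ((X ^ n - C (1 + c * t)) * f) = 0 := by
  have h1 := D.pow
  have h2 := D.sq
  simp only [map_sub, map_mul, map_add, map_one] at h1 ⊢
  linear_combination K * E f * h1 + E (C c) * E f * h2

theorem mul_map_modulus' (f : (ZMod 4)[X]) : K * E' ((X ^ n - C (1 + c * t)) * f) = 0 := by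
  have h1 := D.mul_pow'
  have h2 := D.sq
  simp only [map_sub, map_mul, map_add, map_one, map_C' E E'] at h1 ⊢
  linear_combination E' f * h1 + E (C c) * E' f * h2

theorem dvd1 : h.h11 ∣ X ^ n - 1 := by
  have := D.layer1 (X ^ n - 1) (-C c) (by rw [D.pow, map_neg]; ring)
  simpa [red] using this

theorem dvd2 : h.h22 ∣ X ^ n - 1 := by
  have := D.layer2 (X ^ n - 1) (-(2 * C c)) (by rw [D.pow, map_neg, map_mul, map_ofNat]; ring)
  simpa [red] using this

theorem dvd3 : h.h33 ∣ X ^ n - 1 := by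
  have h0 := D.layer3 (X ^ n - C (1 + c * t)) (by simpa using D.mul_map_modulus 1)
  -- As ct is even, zⁿ - (1 + ct) reduces to zⁿ - 1 modulo 2.
  obtain ⟨e, he⟩ := D.even
  rwa [show (X ^ n - C (1 + c * t) : (ZMod 4)[X]) = X ^ n - 1 - 2 * C e by
    rw [he, C_add, C_mul, C_1, map_ofNat]; ring, map_sub, red_two_mul, sub_zero, map_sub, map_pow, red_X, map_one] at h0

theorem dvd4 : h.h44 ∣ X ^ n - 1 := by
  have := (D.layer4 (X ^ n - 1)).mp (by
    rw [D.pow]; linear_combination 2 * E (C c) * D.sq + K * D.two_mul_ct)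
  simpa [red] using this

theorem dvd43 : h.h44 ∣ h.h33 := by
  obtain ⟨a, ha, h0⟩ := D.exists3
  rw [← ha, ← D.layer4, h0, mul_zero]

theorem dvd21 : h.h22 ∣ h.h11 := by
  obtain ⟨a, b, ha, h0⟩ := D.exists1
  rw [← ha]
  refine D.layer2 a (2 * b) ?_
  rw [map_mul, map_ofNat]
  linear_combination 2 * h0

/-! ### Degree bounds that make the exponents nonnegative. -/

variable (hn : n ≠ 0)
include hn

theorem natDegree_le43 : h.h44.natDegree ≤ h.h33.natDegree :=
  natDegree_le_of_dvd D.dvd43 (ne_zero_of_dvd_X_pow_sub_one hn D.dvd3)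

theorem natDegree_le21 : h.h22.natDegree ≤ h.h11.natDegree :=
  natDegree_le_of_dvd D.dvd21 (ne_zero_of_dvd_X_pow_sub_one hn D.dvd1)

theorem natDegree_h12_le : (lift4 h.h12).natDegree ≤ h.h11.natDegree := by
  have h1 := D.natDegree_le21 hn
  rcases D.deg12 with h0 | h0
  · simp [h0, lift4_zero]
  · exact (natDegree_lift4_le _).trans (by omega)

theorem natDegree_h34_le : (lift4 h.h34).natDegree ≤ h.h33.natDegree := by
  have h1 := D.natDegree_le43 hn
  rcases D.deg34 with h0 | h0
  · simp [h0, lift4_zero]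
  · exact (natDegree_lift4_le _).trans (by omega)

/-- If h₃₃ is no longer than h₁₁, the bounds on h₁₃ and h₁₄ suffice. For t even this holds because
h₃₃ ∣ h₁₁; for t = 1 it can only be avoided at the price of h₁₃ = h₁₁, and then h₄₄ controls h₁₄. -/
theorem natDegree_sh1_le : h.sh1.natDegree ≤ h.h11.natDegree := by
  have h43 := D.natDegree_le43 hn
  have h0 := ne_zero_of_dvd_X_pow_sub_one hn D.dvd1
  have low : h.h33.natDegree ≤ h.h11.natDegree → h.sh1.natDegree ≤ h.h11.natDegree := by
    intro hle
    refine natDegree_add_two_mul_le ?_ ?_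
    · rcases D.deg13 with h3 | h3
      · simp [h3, lift4_zero]
      · exact (natDegree_lift4_le _).trans (by omega)
    · rcases D.deg14 with h4 | h4
      · simp [h4, lift4_zero]
      · exact (natDegree_lift4_le _).trans (by omega)
  rcases D.t_cases with ⟨e, he⟩ | ht
  · obtain ⟨a, b, ha, hab⟩ := D.exists1
    -- Multiply the relation by K; K² = 2eK turns the b-part into an even correction of a.
    have h3 := D.layer3 (a + 2 * (C e * b)) (by
      have hsq := D.sq
      rw [he] at hsq
      simp only [map_add, map_mul, map_ofNat] at hsq ⊢
      linear_combination K * hab - E b * hsq)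
    rw [map_add, red_two_mul, add_zero, ha] at h3
    exact low (natDegree_le_of_dvd h3 h0)
  · by_contra! hlt
    have hlt3 : h.h11.natDegree < h.h33.natDegree := by
      by_contra! hle
      exact absurd (low hle) (by omega)
    -- Here K² = K, so K times the first generator merges both of its parts.
    have htor : K * E (rep4 n h.h11 + 2 * lift4 h.h12 + h.sh1) = 0 := by
      have hsq := D.sq
      rw [ht, C_1, map_one, one_mul] at hsq
      rw [map_add]
      linear_combination K * D.gen1 - E h.sh1 * hsq
    have hrep : rep4 n h.h11 = lift4 h.h11 := by
      rcases rep4_cases hn D.dvd1 with ⟨-, he⟩ | ⟨he, -⟩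
      · exact he
      · have h3 := natDegree_le_of_dvd_X_pow_sub_one hn D.dvd3
        rw [he, natDegree_X_pow_sub_one_two] at hlt3
        omega
    have h13 : h.h13 = h.h11 := by
      have h3 := D.layer3 _ htor
      rw [map_add, map_add, red_two_mul, hrep, GenPolys.sh1, map_add, red_two_mul, red_lift4,
        red_lift4, add_zero, add_zero] at h3
      have hz := eq_zero_of_dvd_of_natDegree_lt h3 (by
        refine (natDegree_add_le _ _).trans_lt (max_lt hlt3 ?_)
        rcases D.deg13 with h3 | h3
        · rw [h3, natDegree_zero]; omega
        · exact h3)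
      rw [← CharTwo.neg_eq h.h11]
      exact (neg_eq_of_add_eq_zero_right hz).symm
    -- With h₁₃ = h₁₁ the merged element is 2(h₁₁ + h₁₂ + h₁₄). If deg 𝗁₁ exceeded deg h₁₁, then h₁₄
    -- would dominate this sum, yet have degree below deg h₄₄, forcing the sum to vanish.
    have h4 : h.h44 ∣ h.h11 + h.h12 + h.h14 := by
      have h4 := (D.layer4 (lift4 h.h11 + lift4 h.h12 + lift4 h.h14)).mp (by
        rw [hrep, GenPolys.sh1, h13] at htor
        simp only [map_add, map_mul, map_ofNat] at htor ⊢
        linear_combination htor)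
      simpa only [map_add, red_lift4] using h4
    have hs : h.sh1.natDegree ≤ max h.h11.natDegree h.h14.natDegree := by
      refine natDegree_add_two_mul_le ?_ ?_
      · rw [h13]; exact (natDegree_lift4_le _).trans (le_max_left _ _)
      · exact (natDegree_lift4_le _).trans (le_max_right _ _)
    have hlt14 : h.h11.natDegree < h.h14.natDegree := by omega
    have h12 : h.h12.natDegree ≤ h.h11.natDegree := by
      have h1 := D.natDegree_le21 hn
      rcases D.deg12 with h0 | h0
      · simp [h0]
      · omega
    have hd : (h.h11 + h.h12 + h.h14).natDegree = h.h14.natDegree := by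
      apply natDegree_add_eq_right_of_natDegree_lt
      exact (natDegree_add_le _ _).trans_lt (by omega)
    have h14 : h.h14.natDegree < h.h44.natDegree := by
      rcases D.deg14 with h5 | h5
      · rw [h5, natDegree_zero] at hlt14; omega
      · exact h5
    have hz := eq_zero_of_dvd_of_natDegree_lt h4 (by omega)
    rw [hz, natDegree_zero] at hd
    omega

/-- The elements `2 y + k u` of the code are peeled off by the last three generators. -/
theorem map'_two_mul_add_eq_zero
    (g2 : 2 * E' (rep4 n h.h22) + K * E' h.sh2 = 0)
    (g3 : K * E' (rep4 n h.h33 + 2 * lift4 h.h34) = 0)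
    (g4 : 2 * (K * E' (rep4 n h.h44)) = 0) (y u : (ZMod 4)[X])
    (hyu : 2 * E y + K * E u = 0) : 2 * E' y + K * E' u = 0 := by
  -- In each layer: reduce the degree below n, divide by h_ii modulo 2, and pass the remainder to
  -- the layer below.
  have step4 : ∀ v, 2 * (K * E v) = 0 → 2 * (K * E' v) = 0 := by
    intro v hv
    obtain ⟨v₀, v₁, hd, rfl⟩ := exists_natDegree_lt_add_mul hn (1 + c * t) v
    rw [map_add] at hv ⊢
    have h0 : 2 * (K * E v₀) = 0 := by linear_combination hv - 2 * D.mul_map_modulus v₁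
    obtain ⟨w, hw⟩ := red_rep4_dvd hn D.dvd4 hd ((D.layer4 v₀).mp h0)
    have hv0 : 2 * v₀ = 2 * (rep4 n h.h44 * lift4 w) :=
      two_mul_eq_of_red_eq (by rw [map_mul, red_lift4, hw])
    have hv' := congrArg E' hv0
    simp only [map_mul, map_ofNat] at hv'
    linear_combination K * hv' + E' (lift4 w) * g4 + 2 * D.mul_map_modulus' v₁
  have step3 : ∀ v, K * E v = 0 → K * E' v = 0 := by
    intro v hv
    obtain ⟨v₀, v₁, hd, rfl⟩ := exists_natDegree_lt_add_mul hn (1 + c * t) v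
    rw [map_add, mul_add, D.mul_map_modulus, add_zero] at hv
    rw [map_add, mul_add, D.mul_map_modulus', add_zero]
    obtain ⟨w, hw⟩ := red_rep4_dvd hn D.dvd3 hd (D.layer3 v₀ hv)
    obtain ⟨b, rfl⟩ := exists_eq_add_two_mul (f := v₀)
      (g := (rep4 n h.h33 + 2 * lift4 h.h34) * lift4 w) (by
        rw [map_mul, map_add, red_two_mul, add_zero, red_lift4, hw])
    have g3E := D.gen3
    rw [map_add E, map_mul E, map_mul E, map_ofNat] at hv
    rw [map_add E', map_mul E', map_mul E', map_ofNat]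
    have h4 := step4 b (by linear_combination hv - E (lift4 w) * g3E)
    linear_combination E' (lift4 w) * g3 + h4
  obtain ⟨y₀, y₁, hd, rfl⟩ := exists_natDegree_lt_add_mul hn 1 y
  rw [C_1] at hyu ⊢
  -- The multiple of zⁿ - 1 moves to the K-part, since 2(zⁿ - 1) = 2cK.
  have h2 : 2 * E y₀ + K * E (u + 2 * (C c * y₁)) = 0 := by
    simp only [map_add, map_mul, map_ofNat, D.pow] at hyu ⊢
    linear_combination hyu
  obtain ⟨w, hw⟩ := red_rep4_dvd hn D.dvd2 hd (D.layer2 _ _ h2)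
  have hy : 2 * y₀ = 2 * (rep4 n h.h22 * lift4 w) :=
    two_mul_eq_of_red_eq (by rw [map_mul, red_lift4, hw])
  have hyE := congrArg E hy
  have hyE' := congrArg E' hy
  have h3 := step3 (u + 2 * (C c * y₁) - h.sh2 * lift4 w) (by
    simp only [map_add, map_sub, map_mul, map_ofNat] at h2 hyE ⊢
    linear_combination h2 - hyE - E (lift4 w) * D.gen2)
  have hp := D.two_mul_pow'
  rw [← map_C' E E'] at hp
  simp only [map_add, map_sub, map_mul, map_ofNat] at h3 hyE' hp ⊢
  linear_combination h3 + hyE' + E' (lift4 w) * g2 + E' y₁ * hp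

/-- In the top layer E'(zⁿ - 1) is not known to be cK, so no reduction is possible; the bound deg a
< n in `EvalReversible` replaces it. -/
theorem evalReversible_of_gens
    (g1 : E' (rep4 n h.h11 + 2 * lift4 h.h12) + K * E' h.sh1 = 0)
    (g2 : 2 * E' (rep4 n h.h22) + K * E' h.sh2 = 0)
    (g3 : K * E' (rep4 n h.h33 + 2 * lift4 h.h34) = 0)
    (g4 : 2 * (K * E' (rep4 n h.h44)) = 0) : EvalReversible n E E' K := by
  intro a b ha _ hab
  obtain ⟨w, hw⟩ := red_rep4_dvd hn D.dvd1 ha (D.layer1 a b hab)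
  obtain ⟨y, rfl⟩ := exists_eq_add_two_mul (f := a)
    (g := (rep4 n h.h11 + 2 * lift4 h.h12) * lift4 w) (by
      rw [map_mul, map_add, red_two_mul, add_zero, red_lift4, hw])
  have hN := D.map'_two_mul_add_eq_zero hn g2 g3 g4 y (b - h.sh1 * lift4 w) (by
    have g1E := D.gen1
    rw [map_add E, map_mul E, map_mul E, map_ofNat] at hab
    rw [map_sub, map_mul]
    linear_combination hab - E (lift4 w) * g1E)
  rw [map_sub, map_mul] at hN
  rw [map_add E', map_mul E', map_mul E', map_ofNat]
  linear_combination hN + E' (lift4 w) * g1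

theorem gens_of_evalReversible (hR : EvalReversible n E E' K) :
    E' (rep4 n h.h11 + 2 * lift4 h.h12) + K * E' h.sh1 = 0 ∧
      2 * E' (rep4 n h.h22) + K * E' h.sh2 = 0 ∧
      K * E' (rep4 n h.h33 + 2 * lift4 h.h34) = 0 ∧
      2 * (K * E' (rep4 n h.h44)) = 0 := by
  have lift : ∀ {p q : (ZMod 2)[X]}, q ∣ X ^ n - 1 → (p = 0 ∨ p.natDegree < q.natDegree) →
      (lift4 p).natDegree < n := by
    intro p q hq hp
    refine natDegree_lift4_lt hn (hp.imp_right fun h1 => ?_)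
    exact h1.trans_le (natDegree_le_of_dvd_X_pow_sub_one hn hq)
  have z : (0 : (ZMod 4)[X]).natDegree < n := by simpa using Nat.pos_of_ne_zero hn
  refine ⟨?_, ?_, ?_, ?_⟩
  · exact hR _ _ (natDegree_add_two_mul_lt (natDegree_rep4_lt hn D.dvd1) (lift D.dvd2 D.deg12))
      (natDegree_add_two_mul_lt (lift D.dvd3 D.deg13) (lift D.dvd4 D.deg14)) D.gen1
  · have := hR (2 * rep4 n h.h22) h.sh2
      ((natDegree_two_mul_le _).trans_lt (natDegree_rep4_lt hn D.dvd2))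
      (natDegree_add_two_mul_lt (lift D.dvd3 D.deg23) (lift D.dvd4 D.deg24))
      (by rw [map_mul, map_ofNat]; exact D.gen2)
    rwa [map_mul, map_ofNat] at this
  · simpa using hR 0 _ z
      (natDegree_add_two_mul_lt (natDegree_rep4_lt hn D.dvd3) (lift D.dvd4 D.deg34))
      (by rw [map_zero, zero_add]; exact D.gen3)
  · have := hR 0 (2 * rep4 n h.h44) z
      ((natDegree_two_mul_le _).trans_lt (natDegree_rep4_lt hn D.dvd4))
      (by rw [map_zero, map_mul, map_ofNat]; linear_combination D.gen4)
    rw [map_zero, map_mul, map_ofNat] at this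
    linear_combination this

/-! ### Self-reciprocity of the diagonal polynomials. -/

theorem isSelfReciprocal1 (g1 : E' (rep4 n h.h11 + 2 * lift4 h.h12) + K * E' h.sh1 = 0) :
    IsSelfReciprocal h.h11 := by
  refine isSelfReciprocal_of_dvd_red_reflect hn D.dvd1 le_rfl ?_
  have hd := D.layer1 (reflect h.h11.natDegree (rep4 n h.h11 + 2 * lift4 h.h12))
    (reflect h.h11.natDegree h.sh1) (by
      rw [map_reflect_eq D.inv (D.natDegree_sh1_le hn), map_reflect_eq D.inv
        (natDegree_add_two_mul_le (natDegree_rep4_le hn D.dvd1) (D.natDegree_h12_le hn))]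
      linear_combination E X ^ h.h11.natDegree * g1)
  rwa [red_reflect, map_add, red_two_mul, add_zero, ← red_reflect] at hd

theorem isSelfReciprocal2 (g2 : 2 * E' (rep4 n h.h22) + K * E' h.sh2 = 0) :
    IsSelfReciprocal h.h22 := by
  -- The polynomial 𝗁₂ may be longer than h₂₂, so both are reflected at the larger degree.
  have hm := le_max_left h.h22.natDegree h.sh2.natDegree
  refine isSelfReciprocal_of_dvd_red_reflect hn D.dvd2 hm ?_
  refine D.layer2 _ (reflect (max h.h22.natDegree h.sh2.natDegree) h.sh2) ?_
  rw [map_reflect_eq D.inv (le_max_right _ _),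
    map_reflect_eq D.inv ((natDegree_rep4_le hn D.dvd2).trans hm)]
  linear_combination E X ^ max h.h22.natDegree h.sh2.natDegree * g2

theorem isSelfReciprocal3 (g3 : K * E' (rep4 n h.h33 + 2 * lift4 h.h34) = 0) :
    IsSelfReciprocal h.h33 := by
  refine isSelfReciprocal_of_dvd_red_reflect hn D.dvd3 le_rfl ?_
  have hd := D.layer3 (reflect h.h33.natDegree (rep4 n h.h33 + 2 * lift4 h.h34)) (by
      rw [map_reflect_eq D.inv
        (natDegree_add_two_mul_le (natDegree_rep4_le hn D.dvd3) (D.natDegree_h34_le hn))]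
      linear_combination E X ^ h.h33.natDegree * g3)
  rwa [red_reflect, map_add, red_two_mul, add_zero, ← red_reflect] at hd

theorem isSelfReciprocal4 (g4 : 2 * (K * E' (rep4 n h.h44)) = 0) :
    IsSelfReciprocal h.h44 := by
  refine isSelfReciprocal_of_dvd_red_reflect hn D.dvd4 le_rfl ?_
  rw [← D.layer4, map_reflect_eq D.inv (natDegree_rep4_le hn D.dvd4)]
  linear_combination E X ^ h.h44.natDegree * g4

/-! ### Conditions (ii)–(iv) as vanishing of the generators at z⁻¹. -/

theorem pow_mul_map'_rep4 {p : (ZMod 2)[X]} (hp : p ∣ X ^ n - 1) (hs : IsSelfReciprocal p) :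
    E X ^ p.natDegree * E' (rep4 n p) = E (rep4 n p) := by
  rw [← map_reflect_eq D.inv (natDegree_rep4_le hn hp), reflect_rep4 hn hp hs]

omit hn in
theorem pow_mul_map'_lift4 {p : (ZMod 2)[X]} {m : ℕ} (hm : p = 0 ∨ p.natDegree ≤ m) :
    E X ^ m * E' (lift4 p) = E (X ^ (m - p.natDegree) * lift4 p.reverse) := by
  rcases hm with rfl | hm
  · simp [lift4_zero]
  · rw [reverse, ← reflect_lift4, map_mul, map_reflect_eq D.inv (natDegree_lift4_le p), map_pow,
      ← mul_assoc, ← pow_add, Nat.sub_add_cancel hm]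

/-- Multiply by the unit z^(deg h₁₁) and subtract the generator itself: the h₁₁ terms cancel by
self-reciprocity. -/
theorem gen1_iff (hs : IsSelfReciprocal h.h11) :
    E' (rep4 n h.h11 + 2 * lift4 h.h12) + K * E' h.sh1 = 0 ↔
      E (2 * (X ^ (h.h11.natDegree - h.h12.natDegree) * lift4 h.h12.reverse - lift4 h.h12))
        + K * E (X ^ (h.h11.natDegree - h.sh1.natDegree) * h.sh1.reverse - h.sh1) = 0 := by
  rw [← pow_mul_eq_zero_iff D.inv h.h11.natDegree]
  have h1 := D.pow_mul_map'_rep4 hn D.dvd1 hs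
  have h2 := D.pow_mul_map'_lift4 (p := h.h12) (m := h.h11.natDegree)
    (D.deg12.imp_right fun h0 => h0.le.trans (D.natDegree_le21 hn))
  have h3 : E X ^ h.h11.natDegree * E' h.sh1 =
      E (X ^ (h.h11.natDegree - h.sh1.natDegree) * h.sh1.reverse) := by
    rw [map_mul, map_reverse_eq D.inv, map_pow, ← mul_assoc, ← pow_add,
      Nat.sub_add_cancel (D.natDegree_sh1_le hn)]
  have hg := D.gen1
  rw [map_mul E, map_sub E, map_sub E, ← h2, ← h3, map_ofNat]
  rw [map_add, map_mul, map_ofNat] at hg ⊢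
  constructor <;> intro h0
  · linear_combination h0 - hg - h1
  · linear_combination h0 + hg + h1

theorem gen2_iff (hs : IsSelfReciprocal h.h22) :
    2 * E' (rep4 n h.h22) + K * E' h.sh2 = 0 ↔
      K * E (X ^ (h.h22.natDegree - h.sh2.natDegree) * h.sh2.reverse
        - X ^ (h.sh2.natDegree - h.h22.natDegree) * h.sh2) = 0 := by
  -- One of the two truncated differences is 0, so both signs of δ are treated at once.
  have e1 : max h.h22.natDegree h.sh2.natDegree =
      h.sh2.natDegree - h.h22.natDegree + h.h22.natDegree := by omega
  have e2 : max h.h22.natDegree h.sh2.natDegree =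
      h.h22.natDegree - h.sh2.natDegree + h.sh2.natDegree := by omega
  rw [← pow_mul_eq_zero_iff D.inv (max h.h22.natDegree h.sh2.natDegree)]
  have h1 : E X ^ max h.h22.natDegree h.sh2.natDegree * E' (rep4 n h.h22) =
      E X ^ (h.sh2.natDegree - h.h22.natDegree) * E (rep4 n h.h22) := by
    rw [e1, pow_add, mul_assoc, D.pow_mul_map'_rep4 hn D.dvd2 hs]
  have h2 : E X ^ max h.h22.natDegree h.sh2.natDegree * E' h.sh2 =
      E X ^ (h.h22.natDegree - h.sh2.natDegree) * E h.sh2.reverse := by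
    rw [map_reverse_eq D.inv, e2, pow_add, mul_assoc]
  have hg := D.gen2
  rw [map_sub, map_mul, map_mul, map_pow, map_pow]
  constructor <;> intro h0
  · linear_combination h0 - 2 * h1 - K * h2 -
      E X ^ (h.sh2.natDegree - h.h22.natDegree) * hg
  · linear_combination h0 + 2 * h1 + K * h2 +
      E X ^ (h.sh2.natDegree - h.h22.natDegree) * hg

theorem gen3_iff (hs : IsSelfReciprocal h.h33) :
    K * E' (rep4 n h.h33 + 2 * lift4 h.h34) = 0 ↔
      h.h44 ∣ X ^ (h.h33.natDegree - h.h34.natDegree) * h.h34.reverse - h.h34 := by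
  have hr : X ^ (h.h33.natDegree - h.h34.natDegree) * h.h34.reverse - h.h34 =
      red (X ^ (h.h33.natDegree - h.h34.natDegree) * lift4 h.h34.reverse - lift4 h.h34) := by
    rw [map_sub, map_mul, map_pow, red_X, red_lift4, red_lift4]
  rw [hr, ← D.layer4, ← pow_mul_eq_zero_iff D.inv h.h33.natDegree]
  have h1 := D.pow_mul_map'_rep4 hn D.dvd3 hs
  have h2 := D.pow_mul_map'_lift4 (p := h.h34) (m := h.h33.natDegree)
    (D.deg34.imp_right fun h0 => h0.le.trans (D.natDegree_le43 hn))
  have hg := D.gen3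
  rw [map_sub, ← h2]
  rw [map_add, map_mul, map_ofNat] at hg ⊢
  constructor <;> intro h0
  · linear_combination h0 - hg - K * h1
  · linear_combination h0 + hg + K * h1

theorem gen4_of (hs : IsSelfReciprocal h.h44) : 2 * (K * E' (rep4 n h.h44)) = 0 := by
  rw [← pow_mul_eq_zero_iff D.inv h.h44.natDegree]
  linear_combination D.gen4 + 2 * K * D.pow_mul_map'_rep4 hn D.dvd4 hs

theorem evalReversible_iff :
    EvalReversible n E E' K ↔
      (IsSelfReciprocal h.h11 ∧ IsSelfReciprocal h.h22 ∧
        IsSelfReciprocal h.h33 ∧ IsSelfReciprocal h.h44) ∧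
      h.h44 ∣ X ^ (h.h33.natDegree - h.h34.natDegree) * h.h34.reverse - h.h34 ∧
      E (2 * (X ^ (h.h11.natDegree - h.h12.natDegree) * lift4 h.h12.reverse - lift4 h.h12))
        + K * E (X ^ (h.h11.natDegree - h.sh1.natDegree) * h.sh1.reverse - h.sh1) = 0 ∧
      K * E (X ^ (h.h22.natDegree - h.sh2.natDegree) * h.sh2.reverse
        - X ^ (h.sh2.natDegree - h.h22.natDegree) * h.sh2) = 0 := by
  constructor
  · intro hR
    obtain ⟨g1, g2, g3, g4⟩ := D.gens_of_evalReversible hn hR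
    have s1 := D.isSelfReciprocal1 hn g1
    have s2 := D.isSelfReciprocal2 hn g2
    have s3 := D.isSelfReciprocal3 hn g3
    exact ⟨⟨s1, s2, s3, D.isSelfReciprocal4 hn g4⟩, (D.gen3_iff hn s3).mp g3,
      (D.gen1_iff hn s1).mp g1, (D.gen2_iff hn s2).mp g2⟩
  · rintro ⟨⟨s1, s2, s3, s4⟩, c2, c3, c4⟩
    exact D.evalReversible_of_gens hn ((D.gen1_iff hn s1).mpr c3) ((D.gen2_iff hn s2).mpr c4)
      ((D.gen3_iff hn s3).mpr c2) (D.gen4_of hn s4)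

end ReversalData

/-! ### Arithmetic of k_θ and of the units α_θ. -/

section Theta

/-- The constants are read off from α - 1 = c k_θ and k_θ² = t k_θ. Evenness of ct gives 2α² = 2 and
k_θ α² = k_θ, which explains why α⁻¹ may be replaced by α there. -/
theorem kTheta_facts (θ : Theta) (α : RTheta θ) (hα : α ∈ alphaUnits θ) :
    ∃ (c t : ZMod 4) (α' : RTheta θ),
      α = 1 + algebraMap (ZMod 4) (RTheta θ) c * kTheta θ ∧ α * α' = 1 ∧
      kTheta θ * kTheta θ = algebraMap (ZMod 4) (RTheta θ) t * kTheta θ ∧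
      2 * α' = 2 * α ∧ kTheta θ * α' = kTheta θ * α ∧
      (∃ e, c * t = 2 * e) ∧ ((∃ e, t = 2 * e) ∨ t = 1) := by
  cases θ with
  | zero =>
    rcases hα with rfl | rfl | rfl
    · exact ⟨1, 0, ⟨1, 3⟩, by decide⟩
    · exact ⟨2, 0, ⟨1, 2⟩, by decide⟩
    · exact ⟨3, 0, ⟨1, 1⟩, by decide⟩
  | one =>
    rcases hα with rfl | rfl | rfl
    · exact ⟨1, 2, ⟨2, 1⟩, by decide⟩
    · exact ⟨2, 2, ⟨3, 2⟩, by decide⟩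
    · exact ⟨3, 2, ⟨0, 3⟩, by decide⟩
  | nu =>
    rcases hα with rfl
    exact ⟨2, 1, ⟨1, 2⟩, by decide⟩

theorem exists_eq_add_kTheta_mul (θ : Theta) (r : RTheta θ) : ∃ x y : ZMod 4,
    r = algebraMap (ZMod 4) (RTheta θ) x + kTheta θ * algebraMap (ZMod 4) (RTheta θ) y := by
  obtain ⟨x, y⟩ := r
  cases θ with
  | zero => exact ⟨x, y, by ext <;> simp [kTheta]⟩
  | one => exact ⟨x - y, y, by ext <;> simp [kTheta]⟩
  | nu => exact ⟨x, y, by revert x y; decide⟩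

end Theta

/-! ### Words, their polynomials and reversal. -/

section Words

variable {R : Type*} [CommRing R] {n : ℕ}

theorem coeff_wordPoly (s : Fin n → R) (j : ℕ) :
    (wordPoly s).coeff j = if hj : j < n then s ⟨j, hj⟩ else 0 := by
  simp only [wordPoly, finsetSum_coeff, coeff_C_mul, coeff_X_pow, mul_ite, mul_one, mul_zero]
  split_ifs with hj
  · rw [Finset.sum_eq_single ⟨j, hj⟩]
    · simp
    · intro i _ hi
      exact if_neg fun he => hi (Fin.ext he.symm)
    · simp
  · exact Finset.sum_eq_zero fun i _ => if_neg fun he => hj (by omega)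

theorem degree_wordPoly_lt (s : Fin n → R) : (wordPoly s).degree < n := by
  rw [degree_lt_iff_coeff_zero]
  intro m hm
  rw [coeff_wordPoly, dif_neg (not_lt.mpr hm)]

theorem wordPoly_coeff {f : R[X]} (hf : f.degree < n) :
    wordPoly (fun i : Fin n => f.coeff i) = f := by
  ext j
  rw [coeff_wordPoly]
  split_ifs with hj
  · rfl
  · exact ((degree_lt_iff_coeff_zero f n).mp hf j (not_lt.mp hj)).symm

theorem wordPoly_rev (s : Fin n → R) :
    wordPoly (fun i => s (Fin.rev i)) = reflect (n - 1) (wordPoly s) := by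
  ext j
  rw [coeff_reflect, coeff_wordPoly, coeff_wordPoly]
  by_cases hj : j < n
  · rw [revAt_le (by omega), dif_pos hj, dif_pos (by omega)]
    congr 1
    ext
    simp only [Fin.val_rev]
    omega
  · rw [dif_neg hj]
    by_cases hj' : j ≤ n - 1
    · rw [revAt_le hj', dif_neg (by omega)]
    · rw [revAt_eq_self_of_lt (by omega), dif_neg hj]

theorem toConsta_wordPoly_injective [NeZero n] (lam : R) {s s' : Fin n → R}
    (h : toConsta n lam (wordPoly s) = toConsta n lam (wordPoly s')) : s = s' := by
  rcases subsingleton_or_nontrivial R with _ | _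
  · exact Subsingleton.elim _ _
  have hn : n ≠ 0 := NeZero.ne n
  have hd := Ideal.mem_span_singleton.mp (Ideal.Quotient.eq.mp h)
  have hz : wordPoly s - wordPoly s' = 0 := by
    by_contra h0
    refine (monic_X_pow_sub_C lam hn).not_dvd_of_degree_lt h0 ?_ hd
    rw [degree_X_pow_sub_C (Nat.pos_of_ne_zero hn)]
    exact (degree_sub_le _ _).trans_lt (max_lt (degree_wordPoly_lt s) (degree_wordPoly_lt s'))
  funext i
  have := congrArg (fun f => coeff f i) (sub_eq_zero.mp hz)
  simpa [coeff_wordPoly] using this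

theorem toConsta_wordPoly_mem_codeSet [NeZero n] (lam : R) (C : Submodule R (Fin n → R))
    (s : Fin n → R) : toConsta n lam (wordPoly s) ∈ codeSet lam C ↔ s ∈ C := by
  constructor
  · rintro ⟨s', hs', he⟩
    rwa [← toConsta_wordPoly_injective lam he]
  · exact fun hs => ⟨s, hs, rfl⟩

end Words

theorem natDegree_lt_of_degree_lt {R : Type*} [CommRing R] {n : ℕ} (hn : n ≠ 0) {f : R[X]}
    (hf : f.degree < n) : f.natDegree < n := by
  rcases eq_or_ne f 0 with rfl | h0
  · simpa using Nat.pos_of_ne_zero hn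
  · exact (natDegree_lt_iff_degree_lt h0).mpr hf

theorem exists_wordPoly_eq (θ : Theta) {n : ℕ} (hn : n ≠ 0) (s : Fin n → RTheta θ) :
    ∃ a b : (ZMod 4)[X], a.natDegree < n ∧ b.natDegree < n ∧
      wordPoly s = toR θ a + Polynomial.C (kTheta θ) * toR θ b := by
  choose x y hxy using fun i => exists_eq_add_kTheta_mul θ (s i)
  refine ⟨wordPoly x, wordPoly y, ?_, ?_, ?_⟩
  · exact natDegree_lt_of_degree_lt hn (degree_wordPoly_lt x)
  · exact natDegree_lt_of_degree_lt hn (degree_wordPoly_lt y)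
  · ext1 j
    simp only [toR, coeff_add, coeff_C_mul, coeff_map, coeff_wordPoly]
    split_ifs with hj
    · exact hxy _
    · simp

theorem toR_reflect (θ : Theta) (m : ℕ) (f : (ZMod 4)[X]) :
    toR θ (reflect m f) = reflect m (toR θ f) :=
  (reflect_map _ _ _).symm

/-! ### From codes to the two evaluations. -/

section Evaluations

variable {θ : Theta} {Q : Type*} [CommRing Q]

/-- The image of a polynomial over `Z₄` under a ring homomorphism on `R_θ[z]`. -/
noncomputable def evalQ (φ : (RTheta θ)[X] →+* Q) : (ZMod 4)[X] →+* Q :=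
  φ.comp (mapRingHom (algebraMap (ZMod 4) (RTheta θ)))

/-- The value of a polynomial over `Z₄` at the image of `α' zⁿ⁻¹`. -/
noncomputable def evalQInv (n : ℕ) (α' : RTheta θ) (φ : (RTheta θ)[X] →+* Q) :
    (ZMod 4)[X] →+* Q :=
  (eval₂RingHom (φ.comp Polynomial.C) (φ (Polynomial.C α' * X ^ (n - 1)))).comp
    (mapRingHom (algebraMap (ZMod 4) (RTheta θ)))

theorem evalQ_add_mul (φ : (RTheta θ)[X] →+* Q) (a b : (ZMod 4)[X]) :
    evalQ φ a + φ (Polynomial.C (kTheta θ)) * evalQ φ b =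
      φ (toR θ a + Polynomial.C (kTheta θ) * toR θ b) := by
  rw [map_add, map_mul]; rfl

theorem reversalData (n : ℕ) [NeZero n] (α : RTheta θ) (hα : α ∈ alphaUnits θ)
    (C : Submodule (RTheta θ) (Fin n → RTheta θ)) (h : GenPolys) (hh : h.IsUniqueForm α C)
    (φ : (RTheta θ)[X] →+* Q) (hφ : ∀ f, φ f = 0 ↔ toConsta n α f ∈ codeSet α C) :
    ∃ (α' : RTheta θ) (c t : ZMod 4), ReversalData n h (evalQ φ) (evalQInv n α' φ)
      (φ (Polynomial.C (kTheta θ))) c t := by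
  obtain ⟨c, t, α', hc, hinv, hsq, h2, hk, heven, ht⟩ := kTheta_facts θ α hα
  have hn : n ≠ 0 := NeZero.ne n
  have hmod : φ (X ^ n) = φ (Polynomial.C α) := by
    rw [← sub_eq_zero, ← map_sub, hφ]
    have h0 : toConsta n α (X ^ n - Polynomial.C α) = 0 :=
      Ideal.Quotient.eq_zero_iff_mem.mpr (Ideal.subset_span rfl)
    rw [h0, hh.span_eq]
    exact Ideal.zero_mem _
  have hadd : ∀ a b : (ZMod 4)[X], evalQ φ a + φ (Polynomial.C (kTheta θ)) * evalQ φ b = 0 ↔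
      toConsta n α (toR θ a + Polynomial.C (kTheta θ) * toR θ b) ∈ codeSet α C := fun a b => by
    rw [evalQ_add_mul, hφ]
  have htor : ∀ a : (ZMod 4)[X], φ (Polynomial.C (kTheta θ)) * evalQ φ a = 0 ↔
      a ∈ torCode α C := fun a => by
    rw [torCode, Set.mem_ofPred_eq, ← hφ, map_mul]; rfl
  have hres : ∀ a b : (ZMod 4)[X], evalQ φ a + φ (Polynomial.C (kTheta θ)) * evalQ φ b = 0 →
      a ∈ resCode α C := fun a b hab => ⟨b, (hadd a b).mp hab⟩
  have hEX : evalQ φ X = φ X := by simp [evalQ]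
  have hEX' : evalQInv n α' φ X = φ (Polynomial.C α' * X ^ (n - 1)) := by simp [evalQInv]
  have hEE : evalQ φ X * evalQInv n α' φ X = 1 := by
    rw [hEX, hEX', ← map_mul, mul_left_comm, ← pow_succ', Nat.sub_add_cancel (NeZero.one_le),
      map_mul, hmod, ← map_mul, ← C_mul, mul_comm, hinv, C_1, map_one]
  have hEC : evalQ φ (Polynomial.C c) = φ (Polynomial.C (algebraMap (ZMod 4) (RTheta θ) c)) := by
    simp [evalQ]
  have hαφ : φ (Polynomial.C α) - 1 =
      evalQ φ (Polynomial.C c) * φ (Polynomial.C (kTheta θ)) := by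
    rw [hEC, ← map_mul, ← C_mul, hc, C_add, map_add, C_1, map_one]; ring
  -- Both sides are inverse to the image of α.
  have hpow' : evalQInv n α' φ (X ^ n) = φ (Polynomial.C α') := by
    have h1 : φ (Polynomial.C α) * evalQInv n α' φ (X ^ n) = 1 := by
      rw [← hmod, map_pow, map_pow, ← hEX, ← mul_pow, hEE, one_pow]
    have h3 : φ (Polynomial.C α) * φ (Polynomial.C α') = 1 := by
      rw [← map_mul, ← C_mul, hinv, C_1, map_one]
    linear_combination φ (Polynomial.C α') * h1 - evalQInv n α' φ (X ^ n) * h3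
  have mem_gen : ∀ {f}, toConsta n α f ∈ ({toConsta n α (h.gen1 θ n), toConsta n α (h.gen2 θ n),
      toConsta n α (h.gen3 θ n), toConsta n α (h.gen4 θ n)} : Set (ConstaRing n α)) →
      φ f = 0 := fun hf => by
    rw [hφ, hh.span_eq]
    exact Ideal.subset_span hf
  refine ⟨α', c, t, ?_⟩
  constructor
  · exact hEE
  · rw [← hαφ, map_sub, map_one, map_pow, hEX, ← hmod, map_pow]
  · rw [← hαφ, map_sub, map_one, hpow']
    have := congrArg (fun r => φ (Polynomial.C r)) h2
    simp only [map_mul, map_ofNat] at this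
    linear_combination this
  · rw [← hαφ, map_sub, map_one, hpow']
    have := congrArg (fun r => φ (Polynomial.C r)) hk
    simp only [map_mul] at this
    linear_combination this
  · have := congrArg (fun r => φ (Polynomial.C r)) hsq
    simp only [map_mul] at this
    rw [this]
    simp [evalQ]
  · exact heven
  · exact ht
  · rw [evalQ_add_mul]; exact mem_gen (Or.inl rfl)
  · rw [← map_ofNat (evalQ φ) 2, ← map_mul, evalQ_add_mul]; exact mem_gen (Or.inr (Or.inl rfl))
  · have := mem_gen (f := h.gen3 θ n) (Or.inr (Or.inr (Or.inl rfl)))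
    rwa [GenPolys.gen3, map_mul] at this
  · have := mem_gen (f := h.gen4 θ n) (Or.inr (Or.inr (Or.inr rfl)))
    rw [GenPolys.gen4, map_mul] at this
    change _ * evalQ φ _ = 0 at this
    rw [map_mul, map_ofNat] at this
    linear_combination this
  · intro a b hab
    obtain ⟨d, hd⟩ := exists_eq_lift4_add a
    refine (hh.layer1 _).mp ⟨d, ?_⟩
    rw [← hd]
    exact hres a b hab
  · intro a b hab
    rw [← hh.layer2, torTwo, Set.mem_ofPred_eq, two_mul_eq_of_red_eq (red_lift4 (red a))]
    exact hres _ b (by rwa [map_mul, map_ofNat])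
  · intro a ha
    obtain ⟨d, hd⟩ := exists_eq_lift4_add a
    refine (hh.layer3 _).mp ⟨d, ?_⟩
    rw [← hd]
    exact (htor a).mp ha
  · intro a
    rw [← hh.layer4, torTwo, Set.mem_ofPred_eq, two_mul_eq_of_red_eq (red_lift4 (red a)), ← htor,
      map_mul, map_ofNat, mul_left_comm]
  · obtain ⟨d, b, hb⟩ := (hh.layer1 h.h11).mpr dvd_rfl
    exact ⟨_, b, by rw [map_add, red_two_mul, red_lift4, add_zero], (hadd _ _).mpr hb⟩
  · obtain ⟨d, hd⟩ := (hh.layer3 h.h33).mpr dvd_rfl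
    exact ⟨_, by rw [map_add, red_two_mul, red_lift4, add_zero], (htor _).mpr hd⟩
  · exact hh.deg12
  · exact hh.deg13
  · exact hh.deg14
  · exact hh.deg23
  · exact hh.deg24
  · exact hh.deg34

/-- The reversed word is the reflection at n - 1, whose value is zⁿ⁻¹ times the value at z⁻¹; the
unit zⁿ⁻¹ does not affect vanishing. -/
theorem isReversible_iff_evalReversible (n : ℕ) [NeZero n] (α : RTheta θ)
    (C : Submodule (RTheta θ) (Fin n → RTheta θ))
    (φ : (RTheta θ)[X] →+* Q) (hφ : ∀ f, φ f = 0 ↔ toConsta n α f ∈ codeSet α C)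
    (E' : (ZMod 4)[X] →+* Q) (hE : evalQ φ X * E' X = 1) :
    IsReversible C ↔
      EvalReversible n (evalQ φ) E' (φ (Polynomial.C (kTheta θ))) := by
  have hn : n ≠ 0 := NeZero.ne n
  have hw : ∀ s, s ∈ C ↔ φ (wordPoly s) = 0 := fun s => by
    rw [hφ, toConsta_wordPoly_mem_codeSet]
  have hrev : ∀ (s : Fin n → RTheta θ) (a b : (ZMod 4)[X]), a.natDegree < n → b.natDegree < n →
      wordPoly s = toR θ a + Polynomial.C (kTheta θ) * toR θ b →
      ((fun i => s (Fin.rev i)) ∈ C ↔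
        E' a + φ (Polynomial.C (kTheta θ)) * E' b = 0) := by
    intro s a b ha hb hs
    rw [hw, wordPoly_rev, hs, reflect_add, reflect_C_mul, ← toR_reflect, ← toR_reflect,
      ← evalQ_add_mul,
      map_reflect_eq hE (Nat.le_sub_one_of_lt ha), map_reflect_eq hE (Nat.le_sub_one_of_lt hb),
      mul_left_comm, ← mul_add, pow_mul_eq_zero_iff hE]
  constructor
  · intro hR a b ha hb hab
    have hdeg : (toR θ a + Polynomial.C (kTheta θ) * toR θ b).degree < n := by
      rw [degree_lt_iff_coeff_zero]
      intro m hm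
      simp [toR, coeff_eq_zero_of_natDegree_lt (ha.trans_le hm),
        coeff_eq_zero_of_natDegree_lt (hb.trans_le hm)]
    have hs := wordPoly_coeff hdeg
    refine (hrev _ a b ha hb hs).mp (hR
      (fun i => (toR θ a + Polynomial.C (kTheta θ) * toR θ b).coeff i) ?_)
    rw [hw, hs, ← evalQ_add_mul, hab]
  · intro hR s hs
    obtain ⟨a, b, ha, hb, he⟩ := exists_wordPoly_eq θ hn s
    refine (hrev s a b ha hb he).mpr (hR a b ha hb ?_)
    rw [evalQ_add_mul, ← he, ← hw]
    exact hs

theorem isReversible_iff_of_ringHom (n : ℕ) [NeZero n] (α : RTheta θ) (hα : α ∈ alphaUnits θ)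
    (C : Submodule (RTheta θ) (Fin n → RTheta θ)) (h : GenPolys) (hh : h.IsUniqueForm α C)
    (φ : (RTheta θ)[X] →+* Q) (hφ : ∀ f, φ f = 0 ↔ toConsta n α f ∈ codeSet α C) :
    IsReversible C ↔
      (IsSelfReciprocal h.h11 ∧ IsSelfReciprocal h.h22 ∧
        IsSelfReciprocal h.h33 ∧ IsSelfReciprocal h.h44) ∧
      h.h44 ∣ X ^ (h.h33.natDegree - h.h34.natDegree) * h.h34.reverse - h.h34 ∧
      toConsta n α
        (toR θ (2 * (X ^ (h.h11.natDegree - h.h12.natDegree) * lift4 h.h12.reverse - lift4 h.h12))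
          + Polynomial.C (kTheta θ) *
            toR θ (X ^ (h.h11.natDegree - h.sh1.natDegree) * h.sh1.reverse - h.sh1))
        ∈ codeSet α C ∧
      X ^ (h.h22.natDegree - h.sh2.natDegree) * h.sh2.reverse
        - X ^ (h.sh2.natDegree - h.h22.natDegree) * h.sh2 ∈ torCode α C := by
  obtain ⟨α', c, t, D⟩ := reversalData n α hα C h hh φ hφ
  rw [isReversible_iff_evalReversible n α C φ hφ _ D.inv, D.evalReversible_iff (NeZero.ne n),
    evalQ_add_mul, hφ, torCode, Set.mem_ofPred_eq, ← hφ (Polynomial.C (kTheta θ) * _), map_mul]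
  rfl

end Evaluations

/- The exponents `deg h₃₃ - deg h₃₄`, `deg h₁₁ - deg h₁₂`, `deg h₁₁ - deg 𝗁₁` are nonnegative
whenever `h₃₄`, `h₁₂`, `𝗁₁` respectively is nonzero (and irrelevant otherwise).  For
`δ = deg h₂₂ - deg 𝗁₂`, one of the two natural subtractions in the last condition is `0` and the
other is `|δ|`: it reads `z ^ δ 𝗁₂* - 𝗁₂ ∈ Tor(C)` if `δ ≥ 0`, and is multiplied by the power
`z ^ (-δ)` of the unit `z` if `δ < 0`. -/
theorem mainTheorem8 (θ : Theta) (n : ℕ) [NeZero n] (α : RTheta θ) (hα : α ∈ alphaUnits θ)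
    (C : Submodule (RTheta θ) (Fin n → RTheta θ)) (hC : IsConstacyclic α C)
    (h : GenPolys) (hh : h.IsUniqueForm α C) :
    IsReversible C ↔
      (IsSelfReciprocal h.h11 ∧ IsSelfReciprocal h.h22 ∧
        IsSelfReciprocal h.h33 ∧ IsSelfReciprocal h.h44) ∧
      h.h44 ∣ X ^ (h.h33.natDegree - h.h34.natDegree) * h.h34.reverse - h.h34 ∧
      toConsta n α
        (toR θ (2 * (X ^ (h.h11.natDegree - h.h12.natDegree) * lift4 h.h12.reverse - lift4 h.h12))
          + Polynomial.C (kTheta θ) *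
            toR θ (X ^ (h.h11.natDegree - h.sh1.natDegree) * h.sh1.reverse - h.sh1))
        ∈ codeSet α C ∧
      X ^ (h.h22.natDegree - h.sh2.natDegree) * h.sh2.reverse
        - X ^ (h.sh2.natDegree - h.h22.natDegree) * h.sh2 ∈ torCode α C := by

  -- The code, as an ideal, is the kernel of the passage to this quotient, so membership becomes
  -- vanishing.
  let J : Ideal (ConstaRing n α) :=
    Ideal.span {toConsta n α (h.gen1 θ n), toConsta n α (h.gen2 θ n),
      toConsta n α (h.gen3 θ n), toConsta n α (h.gen4 θ n)}
  refine isReversible_iff_of_ringHom (Q := ConstaRing n α ⧸ J) n α hα C h hh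
    (φ := (Ideal.Quotient.mk J).comp (toConsta n α)) fun f => ?_
  rw [hh.span_eq]
  exact Ideal.Quotient.eq_zero_iff_mem
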